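/- Let $C$ be a Borel subset of $\mathbb{R}^d$, and let $\mu_1,\dots,\mu_n$ be probability measures on the Borel subsets of $C$ (the preferences of players $N=\{1,\dots,n\}$). All sets below are Borel subsets of $C$, and partitions are into Borel sets, which may be empty. Assume: (CD) for each $i$ and each $A$ with $\mu_i(A)>0$ there is $B\subseteq A$ with $\mu_i(A\cap B)>0$ and $\mu_i(A\cap B^c)>0$; (MAC) if $\mu_i(A)>0$ for some $i$, then $\mu_j(A)>0$ for each $j\ne i$; (RD) for all $i\neq j$ and each $A$ with $\mu_i(A)>0$ and $\mu_j(A)>0$ there is $B\subseteq A$ with $\frac{\mu_i(B)}{\mu_i(A)}\neq\frac{\mu_j(B)}{\mu_j(A)}$. Let $\Gamma=\{S_1,\dots,S_m\}$ be a partition of $N$ into $m$ nonempty coalitions, and let $w$ be a real-valued weight function on subsets of $N$ with $w(S_j)>0$ for all $j$. For $j=1,\dots,m$ put $$\mu_{S_j}(B)=\sup\Big\{\sum_{i\in S_j}\mu_i(D_i)\;:\;(D_i)_{i\in S_j}\text{ a partition of }B\Big\},\qquad \mu_j^w(B)=\frac{\mu_{S_j}(B)}{w(S_j)},$$ $$v(\Gamma,w)=\sup_{(B_1,\dots,B_m)}\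 \min_{1\le j\le m}\mu_j^w(B_j),$$ the last supremum being over all partitions $(B_1,\dots,B_m)$ of $C$. For $\alpha$ in the unit simplex $\Delta_{m-1}\subset\mathbb{R}^m$, a partition value vector (PVV) for $\alpha$ is a vector $u=(\mu_1^w(B_1),\dots,\mu_m^w(B_m))$, where $(B_1,\dots,B_m)$ is a partition of $C$ that maximizes $\sum_{j=1}^m\alpha_j\mu_j^w(B_j)$ among all partitions of $C$. For such a $u$, with $h$ an index such that $u_h=\max_j u_j$, put $$\underline v(u)=\frac{u_h}{1+\sum_{j\ne h}\frac{u_h-u_j}{\mu_j^w(C)}}.$$ Let $\alpha^0\in\Delta_{m-1}$ be arbitrary, and let $(s_t)_{t\ge0}$, $(\alpha^t)_{t\ge 0}$, $(u^t)_{t\ge0}$ be sequences such that for all $t$, writing $\bar u^t=\frac1m\sum_{i=1}^m u_i^t$, $$u^t\text{ is a PVV for }\alpha^t,\qquad \alpha_i^{t+1}=\alpha_i^t-s_t\,(u_i^t-\bar u^t)\quad(1\le i\le m),$$ where $(s_t)$ is a diminishing step size rule, i.e. $s_t>0$, $s_t\to0$ and $\sum_t s_t=+\infty$, that is small enough for $\alpha_i^t-s_t(u_i^t-\bar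 u^t)>0$ to hold for all $t$ and $i$. Then the supremum defining $v(\Gamma,w)$ is attained (it is a maximum), and at least one of the following holds: - $u^{t^*}=(v(\Gamma,w),\dots,v(\Gamma,w))$ for some $t^*\in\mathbb{N}$, and $\underline v(u^{t^*})=v(\Gamma,w)$; - $\lim_{t\to\infty}u^t=(v(\Gamma,w),\dots,v(\Gamma,w))$ and $\lim_{t\to\infty}\underline v(u^t)=v(\Gamma,w)$. -/

import Mathlib

open Set Filter Topology MeasureTheory

noncomputable section

namespace FairDivision

/-- `D` is a partition of `B` into measurable pieces indexed by `ι`; pieces may be empty. -/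
def IsMeasPartition {Ω ι : Type*} [MeasurableSpace Ω] (B : Set Ω) (D : ι → Set Ω) : Prop :=
  (∀ i, MeasurableSet (D i)) ∧ (∀ i j, i ≠ j → Disjoint (D i) (D j)) ∧ (⋃ i, D i) = B

/-- Complete divisibility of the good (CD). -/
def CompleteDivisibility {Ω ι : Type*} [MeasurableSpace Ω] (μ : ι → Measure Ω) : Prop :=
  ∀ i, ∀ A, MeasurableSet A → 0 < μ i A →
    ∃ B, B ⊆ A ∧ MeasurableSet B ∧ 0 < μ i (A ∩ B) ∧ 0 < μ i (A ∩ Bᶜ)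

/-- Mutual absolute continuity (MAC). -/
def MutualAbsContinuity {Ω ι : Type*} [MeasurableSpace Ω] (μ : ι → Measure Ω) : Prop :=
  ∀ i, ∀ A, MeasurableSet A → 0 < μ i A → ∀ j, j ≠ i → 0 < μ j A

/-- Relative disagreement (RD), for each pair of distinct players. -/
def RelativeDisagreement {Ω ι : Type*} [MeasurableSpace Ω] (μ : ι → Measure Ω) : Prop :=
  ∀ i j, i ≠ j → ∀ A, MeasurableSet A → 0 < μ i A → 0 < μ j A →
    ∃ B, B ⊆ A ∧ MeasurableSet B ∧
      (μ i).real B / (μ i).real A ≠ (μ j).real B / (μ j).real A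

/-- `S 0, …, S (m - 1)` is the list of the (nonempty, disjoint, exhaustive) coalitions of a
coalition structure on the players `Fin n`. -/
def IsCoalitionStructure {n m : ℕ} (S : Fin m → Finset (Fin n)) : Prop :=
  (∀ j, (S j).Nonempty) ∧ (∀ j k, j ≠ k → Disjoint (S j) (S k)) ∧ (∀ i, ∃ j, i ∈ S j)

/-- The joint utility `μ_S(B)` of a coalition: the largest total value `∑ i ∈ S, μ i (D i)` over
the measurable partitions `(D i)_{i ∈ S}` of `B`. -/
def coalitionValue {Ω : Type*} [MeasurableSpace Ω] {n : ℕ} (μ : Fin n → Measure Ω)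
    (S : Finset (Fin n)) (B : Set Ω) : ℝ :=
  sSup {x : ℝ | ∃ D : S → Set Ω, IsMeasPartition B D ∧ x = ∑ i : S, (μ i).real (D i)}

/-- The weighted preference `μ_j^w(B) = μ_{S_j}(B) / w(S_j)`. -/
def weightedValue {Ω : Type*} [MeasurableSpace Ω] {n m : ℕ} (μ : Fin n → Measure Ω)
    (S : Fin m → Finset (Fin n)) (w : Finset (Fin n) → ℝ) (j : Fin m) (B : Set Ω) : ℝ :=
  coalitionValue μ (S j) B / w (S j)

/-- The values `min_j μ_j^w(B_j)` of all the divisions `(B_j)` of the good among the coalitions. -/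
def minValues {Ω : Type*} [MeasurableSpace Ω] {n m : ℕ} (μ : Fin n → Measure Ω)
    (S : Fin m → Finset (Fin n)) (w : Finset (Fin n) → ℝ) : Set ℝ :=
  {x : ℝ | ∃ B : Fin m → Set Ω, IsMeasPartition univ B ∧ x = ⨅ j, weightedValue μ S w j (B j)}

/-- The maxmin value `v(Γ, w)`. -/
def maxminValue {Ω : Type*} [MeasurableSpace Ω] {n m : ℕ} (μ : Fin n → Measure Ω)
    (S : Fin m → Finset (Fin n)) (w : Finset (Fin n) → ℝ) : ℝ :=
  sSup (minValues μ S w)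

/-- `B` is a maxsum partition for the coefficients `α`: it maximizes `∑ j, α_j μ_j^w(B_j)` among
all measurable partitions of the good. -/
def IsMaxsumPartition {Ω : Type*} [MeasurableSpace Ω] {n m : ℕ} (μ : Fin n → Measure Ω)
    (S : Fin m → Finset (Fin n)) (w : Finset (Fin n) → ℝ) (α : Fin m → ℝ)
    (B : Fin m → Set Ω) : Prop :=
  IsMeasPartition univ B ∧ ∀ B' : Fin m → Set Ω, IsMeasPartition univ B' →
    ∑ j, α j * weightedValue μ S w j (B' j) ≤ ∑ j, α j * weightedValue μ S w j (B j)

/-- `u` is a partition value vector (PVV) for the coefficients `α`. -/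
def IsPVV {Ω : Type*} [MeasurableSpace Ω] {n m : ℕ} (μ : Fin n → Measure Ω)
    (S : Fin m → Finset (Fin n)) (w : Finset (Fin n) → ℝ) (α u : Fin m → ℝ) : Prop :=
  ∃ B : Fin m → Set Ω, IsMaxsumPartition μ S w α B ∧ ∀ j, u j = weightedValue μ S w j (B j)

/-- The lower bound `u_h / (1 + ∑_{j ≠ h} (u_h - u_j) / μ_j^w(C))` attached to a vector `u` whose
largest coordinate has index `h` (it does not depend on which largest coordinate is chosen). -/
def lowerBound {Ω : Type*} [MeasurableSpace Ω] {n m : ℕ} (μ : Fin n → Measure Ω)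
    (S : Fin m → Finset (Fin n)) (w : Finset (Fin n) → ℝ) (u : Fin m → ℝ) (h : Fin m) : ℝ :=
  u h / (1 + ∑ j ∈ Finset.univ.erase h, (u h - u j) / weightedValue μ S w j univ)

/-- The average of the coordinates of a vector. -/
def average {m : ℕ} (u : Fin m → ℝ) : ℝ := (∑ i, u i) / m

/-- Diminishing step size rule: positive, tending to zero, with divergent sum. -/
def IsDiminishingStepRule (s : ℕ → ℝ) : Prop :=
  (∀ t, 0 < s t) ∧ Tendsto s atTop (𝓝 0) ∧
    Tendsto (fun T => ∑ t ∈ Finset.range T, s t) atTop atTop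

/-- The subgradient iteration: `α^0` is in the unit simplex, `u^t` is a PVV for `α^t`, the next
coefficients are `α^{t+1} = α^t - s_t (u^t - ū^t)`, and the diminishing step sizes `s_t` are small
enough for these to be strictly positive. -/
structure IsSubgradientIteration {Ω : Type*} [MeasurableSpace Ω] {n m : ℕ}
    (μ : Fin n → Measure Ω) (S : Fin m → Finset (Fin n)) (w : Finset (Fin n) → ℝ)
    (s : ℕ → ℝ) (α u : ℕ → Fin m → ℝ) : Prop where
  step : IsDiminishingStepRule s
  small : ∀ t i, 0 < α t i - s t * (u t i - average (u t))
  init : α 0 ∈ stdSimplex ℝ (Fin m)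
  pvv : ∀ t, IsPVV μ S w (α t) (u t)
  update : ∀ t i, α (t + 1) i = α t i - s t * (u t i - average (u t))

end FairDivision

end

/-! Under MAC all `μ i` are equivalent to one measure `ν`, so each weighted preference is
integration against a density `g j`: the largest player density in the coalition, divided by its
weight (`coalitionValue_eq`). RD makes ties `α j * g j = α k * g k` at the maximum null. Hence a
maxsum partition is determined almost everywhere by `α`, and the PVV is a function `U α`
(`isPVV_iff`), continuous on the simplex.

The function `G α = ∑ j, α j * U α j` is a maximum over partitions of functions linear in `α`, thus
convex with subgradient `U α`. At a minimizer of `G` over the simplex all coordinates of `U` agree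
(`IsSupportMap.eq_of_isMin`). Their common value is the maxmin value, since the minimum over
coalitions never exceeds an `α`-weighted average (`isGreatest_minValues`).

The iteration is descent on `G` along `U` minus its mean. Continuity of `U` replaces smoothness
estimates: `G (α t)` tends to its minimum, and compactness turns this into convergence of `U (α t)`,
without convergence of `α t` itself (`IsSupportMap.tendsto_iteration`). -/

noncomputable section

namespace FairDivision

/-! ### Maxsum partitions for densities: uniqueness and continuity of the payoff. -/

section

/-- A finite family of measurable functions admits a measurable partition into argmax sets. -/
theorem exists_isMeasPartition_argmax {Ω ι : Type*} [MeasurableSpace Ω] [Fintype ι] [LinearOrder ι]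
    [Nonempty ι] {a : ι → Ω → ℝ} (ha : ∀ i, Measurable (a i)) {B : Set Ω} (hB : MeasurableSet B) :
    ∃ D : ι → Set Ω, IsMeasPartition B D ∧ ∀ i, ∀ x ∈ D i, ∀ k, a k x ≤ a i x := by
  have hle (i k : ι) : MeasurableSet {x | a k x ≤ a i x} := measurableSet_le (ha k) (ha i)
  have hlt (i k : ι) : MeasurableSet {x | k < i → a k x < a i x} := by
    by_cases h : k < i
    · simpa [h] using measurableSet_lt (ha k) (ha i)
    · simp [h]
  -- Ties go to the smallest maximizing index: strictness is required only against smaller indices.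
  refine ⟨fun i => B ∩ ((⋂ k, {x | a k x ≤ a i x}) ∩ ⋂ k, {x | k < i → a k x < a i x}),
    ⟨fun i => hB.inter ((MeasurableSet.iInter (hle i)).inter (MeasurableSet.iInter (hlt i))),
      ?_, ?_⟩, ?_⟩
  · intro i j hij
    rw [Set.disjoint_left]
    rintro x ⟨-, hi, hi'⟩ ⟨-, hj, hj'⟩
    simp only [mem_iInter, mem_ofPred_eq] at hi hi' hj hj'
    rcases lt_or_gt_of_ne hij with h | h
    · exact absurd (hj' i h) (not_lt.2 (hi j))
    · exact absurd (hi' j h) (not_lt.2 (hj i))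
  · ext x
    simp only [mem_iUnion, mem_inter_iff, mem_iInter, mem_ofPred_eq]
    refine ⟨fun ⟨i, h, _⟩ => h, fun h => ?_⟩
    obtain ⟨i₀, -, hi₀⟩ := Finset.exists_max_image Finset.univ (fun i => a i x) Finset.univ_nonempty
    have hne : (Finset.univ.filter fun i => ∀ k, a k x ≤ a i x).Nonempty :=
      ⟨i₀, by simpa using hi₀⟩
    have hmem := Finset.min'_mem _ hne
    refine ⟨Finset.min' _ hne, h, ?_, ?_⟩
    · simpa using hmem
    · intro k hk
      by_contra hcon
      refine absurd hk (not_lt.2 (Finset.min'_le _ _ ?_))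
      simp only [Finset.mem_filter, Finset.mem_univ, true_and] at hmem ⊢
      exact fun l => (hmem l).trans (not_lt.1 hcon)
  · rintro i x ⟨-, hi, -⟩ k
    simp only [mem_iInter, mem_ofPred_eq] at hi
    exact hi k

theorem IsMeasPartition.sum_setIntegral {Ω ι : Type*} [MeasurableSpace Ω] [Fintype ι]
    {ν : Measure Ω} {B : Set Ω} {D : ι → Set Ω} (hD : IsMeasPartition B D) {F : Ω → ℝ}
    (hF : Integrable F ν) : ∑ i, ∫ x in D i, F x ∂ν = ∫ x in B, F x ∂ν := by
  rw [← hD.2.2, integral_iUnion_fintype hD.1 (fun i j hij => hD.2.1 i j hij)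
    fun i => hF.integrableOn]

/-- The points at which `α j * g j` strictly exceeds every other `α k * g k`. -/
def dominance {Ω ι : Type*} (g : ι → Ω → ℝ) (α : ι → ℝ) (j : ι) : Set Ω :=
  {x | ∀ k, k ≠ j → α k * g k x < α j * g j x}

/-- The integrals of `g j` over the dominance sets. -/
def payoff {Ω ι : Type*} [MeasurableSpace Ω] (ν : Measure Ω) (g : ι → Ω → ℝ) (α : ι → ℝ) (j : ι) :
    ℝ :=
  ∫ x in dominance g α j, g j x ∂ν

/-- Positive integrable densities, no two of which are proportional on a set of positive
measure. -/
structure IsDisagreeing {Ω ι : Type*} [MeasurableSpace Ω] (ν : Measure Ω) (g : ι → Ω → ℝ) :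
    Prop where
  measurable : ∀ j, Measurable (g j)
  integrable : ∀ j, Integrable (g j) ν
  pos : ∀ j, ∀ᵐ x ∂ν, 0 < g j x
  ne_mul : ∀ i j, i ≠ j → ∀ c : ℝ, ∀ᵐ x ∂ν, g i x ≠ c * g j x

theorem dominance_unique {Ω ι : Type*} {g : ι → Ω → ℝ} {α : ι → ℝ} {x : Ω} {i j : ι} (hi : x ∈ dominance g α i) (hj : x ∈ dominance g α j) :
    i = j := by
  by_contra hij
  exact lt_asymm (hi j (Ne.symm hij)) (hj i hij)

theorem sum_indicator_eq {Ω ι : Type*} [Fintype ι] {B : ι → Set Ω} (hB : ∀ i j, ∀ x, x ∈ B i → x ∈ B j → i = j)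
    (a : ι → Ω → ℝ) {x : Ω} {i : ι} (hx : x ∈ B i) :
    ∑ j, (B j).indicator (a j) x = a i x := by
  rw [Finset.sum_eq_single i, indicator_of_mem hx]
  · exact fun j _ hj => indicator_of_notMem (fun h => hj (hB j i x h hx)) _
  · simp

theorem IsMeasPartition.unique {Ω ι : Type*} [MeasurableSpace Ω] {B : ι → Set Ω} {A : Set Ω} (hB : IsMeasPartition A B) (i j : ι)
    (x : Ω) (hi : x ∈ B i) (hj : x ∈ B j) : i = j := by
  by_contra hij
  exact Set.disjoint_left.1 (hB.2.1 i j hij) hi hj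

theorem IsMeasPartition.exists_mem {Ω ι : Type*} [MeasurableSpace Ω] {B : ι → Set Ω} (hB : IsMeasPartition univ B) (x : Ω) :
    ∃ i, x ∈ B i :=
  mem_iUnion.1 (hB.2.2.symm ▸ mem_univ x)

variable {Ω ι : Type*} [MeasurableSpace Ω] [Fintype ι] {ν : Measure Ω} {g : ι → Ω → ℝ}
  {α : ι → ℝ}

theorem measurableSet_dominance (hg : IsDisagreeing ν g) (α : ι → ℝ) (j : ι) :
    MeasurableSet (dominance g α j) := by
  have : dominance g α j = ⋂ k, {x | k ≠ j → α k * g k x < α j * g j x} := by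
    ext x; simp [dominance]
  rw [this]
  refine MeasurableSet.iInter fun k => ?_
  by_cases h : k = j
  · simp [h]
  · simpa [h] using
      measurableSet_lt ((hg.measurable k).const_mul _) ((hg.measurable j).const_mul _)

theorem exists_pos_of_mem_stdSimplex (hα : α ∈ stdSimplex ℝ ι) : ∃ k, 0 < α k := by
  by_contra! hcon
  have := Finset.sum_nonpos fun i (_ : i ∈ Finset.univ) => hcon i
  linarith [hα.2]

/-- Ties for the maximum are null: the maximum is positive because some coefficient is, so a tie
would make two densities proportional with ratio `α j / α k`. -/
theorem IsDisagreeing.ae_mem_dominance (hg : IsDisagreeing ν g) (hα : α ∈ stdSimplex ℝ ι) :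
    ∀ᵐ x ∂ν, ∀ j, (∀ k, α k * g k x ≤ α j * g j x) → x ∈ dominance g α j := by
  have h1 : ∀ᵐ x ∂ν, ∀ j, 0 < g j x := ae_all_iff.2 hg.pos
  have h2 : ∀ᵐ x ∂ν, ∀ i j, i ≠ j → g i x ≠ α j / α i * g j x := by
    simp only [ae_all_iff]
    exact fun i j hij => hg.ne_mul i j hij _
  filter_upwards [h1, h2] with x hpos hne j hj k hk
  refine lt_of_le_of_ne (hj k) fun heq => ?_
  obtain ⟨l, hl⟩ := exists_pos_of_mem_stdSimplex hα
  have hjpos : 0 < α k * g k x := heq ▸ (mul_pos hl (hpos l)).trans_le (hj l)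
  have hk0 : 0 < α k := pos_of_mul_pos_left hjpos (hpos k).le
  refine hne k j hk ?_
  field_simp
  linarith

theorem IsDisagreeing.ae_exists_mem_dominance [Nonempty ι] (hg : IsDisagreeing ν g)
    (hα : α ∈ stdSimplex ℝ ι) : ∀ᵐ x ∂ν, ∃ j, x ∈ dominance g α j := by
  filter_upwards [hg.ae_mem_dominance hα] with x hx
  obtain ⟨j, -, hj⟩ :=
    Finset.exists_max_image Finset.univ (fun i => α i * g i x) Finset.univ_nonempty
  exact ⟨j, hx j fun k => hj k (Finset.mem_univ k)⟩

theorem sum_mul_setIntegral_eq (hg : IsDisagreeing ν g) {B : ι → Set Ω}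
    (hB : ∀ j, MeasurableSet (B j)) (α : ι → ℝ) :
    ∑ j, α j * ∫ x in B j, g j x ∂ν =
      ∫ x, ∑ j, (B j).indicator (fun x => α j * g j x) x ∂ν := by
  rw [integral_finsetSum]
  · refine Finset.sum_congr rfl fun j _ => ?_
    rw [integral_indicator (hB j), integral_const_mul]
  · exact fun j _ => ((hg.integrable j).const_mul _).indicator (hB j)

theorem IsDisagreeing.ae_le [Nonempty ι] (hg : IsDisagreeing ν g) (hα : α ∈ stdSimplex ℝ ι)
    {B : ι → Set Ω} (hB : IsMeasPartition univ B) :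
    (fun x => ∑ j, (B j).indicator (fun x => α j * g j x) x) ≤ᵐ[ν]
      fun x => ∑ j, (dominance g α j).indicator (fun x => α j * g j x) x := by
  filter_upwards [hg.ae_exists_mem_dominance hα] with x ⟨j, hj⟩
  obtain ⟨i, hi⟩ := hB.exists_mem x
  rw [sum_indicator_eq hB.unique _ hi, sum_indicator_eq (fun _ _ _ => dominance_unique) _ hj]
  by_cases hij : i = j
  · rw [hij]
  · exact (hj i hij).le

theorem IsDisagreeing.integrable_sum_indicator (hg : IsDisagreeing ν g) {B : ι → Set Ω}
    (hB : ∀ j, MeasurableSet (B j)) (α : ι → ℝ) :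
    Integrable (fun x => ∑ j, (B j).indicator (fun x => α j * g j x) x) ν :=
  integrable_finsetSum _ fun j _ => ((hg.integrable j).const_mul _).indicator (hB j)

/-- No partition beats the dominance sets. -/
theorem IsDisagreeing.sum_le_sum_payoff [Nonempty ι] (hg : IsDisagreeing ν g)
    (hα : α ∈ stdSimplex ℝ ι) {B : ι → Set Ω} (hB : IsMeasPartition univ B) :
    ∑ j, α j * ∫ x in B j, g j x ∂ν ≤ ∑ j, α j * payoff ν g α j := by
  simp only [payoff]
  rw [sum_mul_setIntegral_eq hg hB.1, sum_mul_setIntegral_eq hg (measurableSet_dominance hg α)]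
  exact integral_mono_ae (hg.integrable_sum_indicator hB.1 α)
    (hg.integrable_sum_indicator (measurableSet_dominance hg α) α) (hg.ae_le hα hB)

/-- A partition that does as well as the dominance sets agrees with them almost everywhere. -/
theorem IsDisagreeing.setIntegral_eq_payoff [Nonempty ι] (hg : IsDisagreeing ν g)
    (hα : α ∈ stdSimplex ℝ ι) {B : ι → Set Ω} (hB : IsMeasPartition univ B)
    (hopt : ∑ j, α j * payoff ν g α j ≤ ∑ j, α j * ∫ x in B j, g j x ∂ν) (j : ι) :
    ∫ x in B j, g j x ∂ν = payoff ν g α j := by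
  have heq := le_antisymm hopt (hg.sum_le_sum_payoff hα hB)
  simp only [payoff] at heq
  rw [sum_mul_setIntegral_eq hg hB.1, sum_mul_setIntegral_eq hg (measurableSet_dominance hg α),
    eq_comm, integral_eq_iff_of_ae_le (hg.integrable_sum_indicator hB.1 α)
      (hg.integrable_sum_indicator (measurableSet_dominance hg α) α) (hg.ae_le hα hB)] at heq
  refine setIntegral_congr_set ?_
  filter_upwards [heq, hg.ae_exists_mem_dominance hα] with x hx ⟨k, hk⟩
  obtain ⟨i, hi⟩ := hB.exists_mem x
  rw [sum_indicator_eq hB.unique _ hi, sum_indicator_eq (fun _ _ _ => dominance_unique) _ hk] at hx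
  have hik : i = k := by
    by_contra hik
    exact absurd hx (hk i hik).ne
  subst hik
  exact propext ⟨fun h => hB.unique _ _ x hi h ▸ hk, fun h => dominance_unique hk h ▸ hi⟩

/-- The dominance sets can be completed to a partition. -/
theorem IsDisagreeing.exists_partition [Nonempty ι] (hg : IsDisagreeing ν g)
    (hα : α ∈ stdSimplex ℝ ι) :
    ∃ B, IsMeasPartition univ B ∧ ∀ j, ∫ x in B j, g j x ∂ν = payoff ν g α j := by
  classical
  let _ : LinearOrder ι := LinearOrder.lift' (Fintype.equivFin ι) (Fintype.equivFin ι).injective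
  obtain ⟨B, hB, hmax⟩ := exists_isMeasPartition_argmax
    (fun j => (hg.measurable j).const_mul (α j)) MeasurableSet.univ
  refine ⟨B, hB, fun j => setIntegral_congr_set ?_⟩
  filter_upwards [hg.ae_mem_dominance hα] with x hx
  obtain ⟨i, hi⟩ := hB.exists_mem x
  have hi' := hx i (hmax i x hi)
  exact propext ⟨fun h => hx j (hmax j x h), fun h => dominance_unique hi' h ▸ hi⟩

theorem IsDisagreeing.sum_payoff_le [Nonempty ι] (hg : IsDisagreeing ν g) {β : ι → ℝ}
    (hα : α ∈ stdSimplex ℝ ι) (hβ : β ∈ stdSimplex ℝ ι) :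
    ∑ j, β j * payoff ν g α j ≤ ∑ j, β j * payoff ν g β j := by
  obtain ⟨B, hB, h⟩ := hg.exists_partition hα
  simpa only [h] using hg.sum_le_sum_payoff hβ hB

/-- With coefficient zero, dominating would need some positive `α k * g k` to be negative. This is
what keeps minimizers off the boundary of the simplex. -/
theorem IsDisagreeing.payoff_eq_zero (hg : IsDisagreeing ν g)
    (hα : α ∈ stdSimplex ℝ ι) {i : ι} (hi : α i = 0) : payoff ν g α i = 0 := by
  obtain ⟨k, hk⟩ := exists_pos_of_mem_stdSimplex hα
  have hki : k ≠ i := by rintro rfl; exact hk.ne' hi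
  refine setIntegral_measure_zero _ (measure_eq_zero_iff_ae_notMem.2 ?_)
  filter_upwards [hg.pos k] with x hx hmem
  have := hmem k hki
  rw [hi, zero_mul] at this
  exact absurd this (not_lt.2 (mul_pos hk hx).le)

theorem IsDisagreeing.sum_payoff_pos [Nonempty ι] [NeZero ν] (hg : IsDisagreeing ν g)
    (hα : α ∈ stdSimplex ℝ ι) : 0 < ∑ j, α j * payoff ν g α j := by
  classical
  obtain ⟨k, hk⟩ := exists_pos_of_mem_stdSimplex hα
  -- Compare with giving everything to one index of positive coefficient.
  have hB : IsMeasPartition univ fun j : ι => if j = k then (univ : Set Ω) else ∅ := by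
    refine ⟨fun j => ?_, fun i j hij => ?_, ?_⟩
    · dsimp only; split_ifs <;> simp
    · dsimp only
      by_cases hi : i = k
      · rw [if_neg (show j ≠ k from fun h => hij (hi.trans h.symm))]; simp
      · simp [hi]
    · exact eq_univ_of_forall fun x => mem_iUnion.2 ⟨k, by simp⟩
  refine lt_of_lt_of_le ?_ (hg.sum_le_sum_payoff hα hB)
  rw [Finset.sum_eq_single k (fun j _ hj => by simp [hj]) (by simp)]
  refine mul_pos hk ?_
  simp only [if_true, setIntegral_univ]
  rw [integral_pos_iff_support_of_nonneg_ae ((hg.pos k).mono fun x hx => hx.le) (hg.integrable k)]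
  have : Function.support (g k) =ᵐ[ν] univ := by
    filter_upwards [hg.pos k] with x hx
    exact propext ⟨fun _ => trivial, fun _ => hx.ne'⟩
  rw [measure_congr this]
  exact Measure.measure_univ_pos.2 (NeZero.ne ν)

/-- For fixed `x`, strict dominance is an open condition on the coefficients. Almost every `x` is
strictly dominated by some index at `α`, so the indicators are eventually constant and dominated
convergence applies. -/
theorem IsDisagreeing.continuousOn_payoff [Nonempty ι] (hg : IsDisagreeing ν g) :
    ContinuousOn (payoff ν g) (stdSimplex ℝ ι) := by
  rw [continuousOn_pi]
  intro j α hα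
  have hrw : (fun β => payoff ν g β j) =
      fun β => ∫ x, (dominance g β j).indicator (g j) x ∂ν := by
    ext β
    exact (integral_indicator (measurableSet_dominance hg β j)).symm
  rw [ContinuousWithinAt, hrw, show payoff ν g α j = _ from congrFun hrw α]
  have hopen (x : Ω) (k : ι) (hx : x ∈ dominance g α k) :
      ∀ᶠ β in 𝓝[stdSimplex ℝ ι] α, x ∈ dominance g β k := by
    refine Filter.Eventually.filter_mono nhdsWithin_le_nhds ?_
    refine eventually_all.2 fun l => ?_
    by_cases hl : l = k
    · simp [hl]
    · have h : ContinuousAt (fun β : ι → ℝ => β k * g k x - β l * g l x) α := by fun_prop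
      filter_upwards [h.eventually (lt_mem_nhds (sub_pos.2 (hx l hl)))] with β hβ _
      linarith
  refine tendsto_integral_filter_of_dominated_convergence (fun x => ‖g j x‖) ?_ ?_
    (hg.integrable j).norm ?_
  · exact Eventually.of_forall fun β =>
      ((hg.measurable j).indicator (measurableSet_dominance hg β j)).aestronglyMeasurable
  · exact Eventually.of_forall fun β => ae_of_all _ fun x => norm_indicator_le_norm_self _ _
  · filter_upwards [hg.ae_exists_mem_dominance hα] with x ⟨k, hk⟩
    refine tendsto_const_nhds.congr' ?_
    filter_upwards [hopen x k hk] with β hβ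
    by_cases hkj : k = j
    · subst hkj
      rw [indicator_of_mem hk, indicator_of_mem hβ]
    · rw [indicator_of_notMem fun h => hkj (dominance_unique hk h),
        indicator_of_notMem fun h => hkj (dominance_unique hβ h)]

end

/-! ### Convex minimization and the subgradient iteration on the simplex. -/

section

/-- A nonnegative sequence tends to zero if it decreases at a rate proportional to divergent,
vanishing steps wherever it is not small, and increases at most at such a rate elsewhere. -/
theorem tendsto_zero_of_descent {a s : ℕ → ℝ} (ha : ∀ t, 0 ≤ a t) (hs : IsDiminishingStepRule s)
    {M : ℝ} (hM : ∀ t, a (t + 1) ≤ a t + s t * M)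
    (hdesc : ∀ ε > 0, ∃ δ > 0, ∀ᶠ t in atTop, ε ≤ a t → a (t + 1) ≤ a t - s t * δ) :
    Tendsto a atTop (𝓝 0) := by
  rw [Metric.tendsto_atTop]
  intro ε hε
  obtain ⟨δ, hδ, hev⟩ := hdesc (ε / 2) (by positivity)
  have hsmall : ∀ᶠ t in atTop, s t * M < ε / 2 := by
    have := hs.2.1.mul_const M
    rw [zero_mul] at this
    exact this.eventually (gt_mem_nhds (by positivity))
  obtain ⟨T, hT⟩ := eventually_atTop.1 (hev.and hsmall)
  -- Staying above `ε / 2` forever would force a total decrease of `δ` times a divergent sum.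
  obtain ⟨t₀, ht₀, hat₀⟩ : ∃ t, T ≤ t ∧ a t < ε / 2 := by
    by_contra! hcon
    have hind : ∀ k, a (T + k) + (∑ t ∈ Finset.range (T + k), s t) * δ ≤
        a T + (∑ t ∈ Finset.range T, s t) * δ := by
      intro k
      induction k with
      | zero => simp
      | succ k ih =>
        have := (hT (T + k) (by omega)).1 (hcon _ (by omega))
        rw [← add_assoc, Finset.sum_range_succ]
        linarith
    obtain ⟨N, hN⟩ := eventually_atTop.1 (hs.2.2.eventually_gt_atTop
      ((a T + (∑ t ∈ Finset.range T, s t) * δ) / δ))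
    have h1 := hN (T + N) (by omega)
    rw [div_lt_iff₀ hδ] at h1
    linarith [hind N, ha (T + N)]
  refine ⟨t₀, fun t ht => ?_⟩
  rw [Real.dist_eq, sub_zero, abs_of_nonneg (ha t)]
  -- Below `ε / 2` one step adds less than `ε / 2`; between `ε / 2` and `ε` the sequence decreases.
  -- So `ε` is never crossed again.
  induction t, ht using Nat.le_induction with
  | base => linarith
  | succ t ht ih =>
    obtain ⟨h1, h2⟩ := hT t (by omega)
    rcases le_or_gt (ε / 2) (a t) with h | h
    · have := h1 h
      have := mul_pos (hs.1 t) hδ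
      linarith
    · linarith [hM t]

variable {m : ℕ} {U : (Fin m → ℝ) → Fin m → ℝ}

/-- The properties of the payoff map used in the analysis of the iteration: it is a continuous
selection of subgradients of the homogeneous convex function `α ↦ ∑ j, α j * U α j`. -/
structure IsSupportMap (U : (Fin m → ℝ) → Fin m → ℝ) : Prop where
  continuousOn : ContinuousOn U (stdSimplex ℝ (Fin m))
  sum_le : ∀ α ∈ stdSimplex ℝ (Fin m), ∀ β ∈ stdSimplex ℝ (Fin m),
    ∑ j, β j * U α j ≤ ∑ j, β j * U β j
  eq_zero : ∀ α ∈ stdSimplex ℝ (Fin m), ∀ i, α i = 0 → U α i = 0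
  pos : ∀ α ∈ stdSimplex ℝ (Fin m), 0 < ∑ j, α j * U α j

theorem IsSupportMap.continuousOn_sum (hU : IsSupportMap U) :
    ContinuousOn (fun α => ∑ j, α j * U α j) (stdSimplex ℝ (Fin m)) :=
  continuousOn_finsetSum _ fun j _ =>
    (continuous_apply j).continuousOn.mul (continuousOn_pi.1 hU.continuousOn j)

/-- At a minimizer the support map is constant. -/
theorem IsSupportMap.eq_of_isMin (hU : IsSupportMap U) {α : Fin m → ℝ}
    (hα : α ∈ stdSimplex ℝ (Fin m))
    (hmin : ∀ β ∈ stdSimplex ℝ (Fin m), ∑ j, α j * U α j ≤ ∑ j, β j * U β j) (i : Fin m) :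
    U α i = ∑ j, α j * U α j := by
  -- Move from `α` toward the vertex `i`. Minimality at `α` and the support inequality give a
  -- nonnegative slope for `U (γ ε)`; continuity passes this to `U α`.
  have key : ∀ i, ∑ j, α j * U α j ≤ U α i := by
    intro i
    have hβ : Pi.single i (1 : ℝ) ∈ stdSimplex ℝ (Fin m) := single_mem_stdSimplex ℝ i
    set β : Fin m → ℝ := Pi.single i (1 : ℝ)
    let γ : ℝ → Fin m → ℝ := fun ε => α + ε • (β - α)
    have hγmem : ∀ ε ∈ Ioc (0 : ℝ) 1, γ ε ∈ stdSimplex ℝ (Fin m) := fun ε hε =>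
      (convex_stdSimplex ℝ (Fin m)).add_smul_sub_mem hα hβ ⟨hε.1.le, hε.2⟩
    have hγ0 : Tendsto γ (𝓝[>] 0) (𝓝[stdSimplex ℝ (Fin m)] α) := by
      refine tendsto_nhdsWithin_iff.2 ⟨?_, ?_⟩
      · have : Continuous γ := by fun_prop
        have h := (this.tendsto 0).mono_left (nhdsWithin_le_nhds (s := Ioi (0 : ℝ)))
        simpa [γ] using h
      · filter_upwards [Ioc_mem_nhdsGT (zero_lt_one' ℝ)] with ε hε using hγmem ε hε
    have hineq : ∀ᶠ ε in 𝓝[>] (0 : ℝ), 0 ≤ ∑ j, (β j - α j) * U (γ ε) j := by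
      filter_upwards [Ioc_mem_nhdsGT (zero_lt_one' ℝ)] with ε hε
      have h1 := hmin _ (hγmem ε hε)
      have h2 := hU.sum_le _ (hγmem ε hε) α hα
      have h3 : ∑ j, γ ε j * U (γ ε) j =
          ∑ j, α j * U (γ ε) j + ε * ∑ j, (β j - α j) * U (γ ε) j := by
        rw [Finset.mul_sum, ← Finset.sum_add_distrib]
        refine Finset.sum_congr rfl fun j _ => ?_
        simp only [γ, Pi.add_apply, Pi.smul_apply, Pi.sub_apply, smul_eq_mul]
        ring
      exact nonneg_of_mul_nonneg_right (by linarith) hε.1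
    have hlim : Tendsto (fun ε => ∑ j, (β j - α j) * U (γ ε) j) (𝓝[>] 0)
        (𝓝 (∑ j, (β j - α j) * U α j)) := by
      refine tendsto_finsetSum _ fun j _ => tendsto_const_nhds.mul ?_
      exact ((continuousOn_pi.1 hU.continuousOn j) α hα).tendsto.comp hγ0
    have h := ge_of_tendsto hlim hineq
    simp only [sub_mul, Finset.sum_sub_distrib] at h
    have hβsum : ∑ j, β j * U α j = U α i := by
      rw [Finset.sum_eq_single i (fun j _ hj => by simp [β, hj]) (by simp)]
      simp [β]
    linarith
  have hpos := hU.pos α hα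
  have hαi : 0 < α i := by
    refine lt_of_le_of_ne (hα.1 i) fun h => ?_
    have := key i
    rw [hU.eq_zero α hα i h.symm] at this
    linarith
  -- Nonnegative excesses with zero weighted mean vanish wherever the weight is positive.
  have hsum : ∑ j, α j * (U α j - ∑ k, α k * U α k) = 0 := by
    simp only [mul_sub, Finset.sum_sub_distrib, ← Finset.sum_mul, hα.2]
    ring
  have h0 := (Finset.sum_eq_zero_iff_of_nonneg fun j _ =>
    mul_nonneg (hα.1 j) (sub_nonneg.2 (key j))).1 hsum i (Finset.mem_univ i)
  linarith [(mul_eq_zero.1 h0).resolve_left hαi.ne']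

theorem IsSupportMap.exists_min (hU : IsSupportMap U) (hm : 0 < m) :
    ∃ α ∈ stdSimplex ℝ (Fin m), ∃ v, (∀ i, U α i = v) ∧
      (∀ β ∈ stdSimplex ℝ (Fin m), v ≤ ∑ j, β j * U β j) ∧
      ∀ β ∈ stdSimplex ℝ (Fin m), ∑ j, β j * U β j = v → ∀ i, U β i = v := by
  obtain ⟨α, hα, hmin⟩ := (isCompact_stdSimplex ℝ (Fin m)).exists_isMinOn
    ⟨_, single_mem_stdSimplex ℝ (⟨0, hm⟩ : Fin m)⟩ hU.continuousOn_sum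
  rw [isMinOn_iff] at hmin
  refine ⟨α, hα, ∑ j, α j * U α j, hU.eq_of_isMin hα hmin, hmin, fun β hβ h i => ?_⟩
  rw [hU.eq_of_isMin hβ (fun γ hγ => h ▸ hmin γ hγ) i, h]

theorem sum_sub_average (u : Fin m → ℝ) : ∑ i, (u i - average u) = 0 := by
  rcases Nat.eq_zero_or_pos m with rfl | hm
  · simp
  · have : (m : ℝ) ≠ 0 := by positivity
    simp only [Finset.sum_sub_distrib, Finset.sum_const, Finset.card_univ, Fintype.card_fin,
      nsmul_eq_mul, average]
    field_simp
    ring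

theorem sum_mul_sub_average (c : ℝ) (x u : Fin m → ℝ) (hx : ∑ i, x i = c) :
    ∑ i, x i * (u i - average u) = ∑ i, x i * u i - c * average u := by
  simp only [mul_sub, Finset.sum_sub_distrib, ← Finset.sum_mul, hx]

theorem mem_stdSimplex_of_iteration {s : ℕ → ℝ} {α u : ℕ → Fin m → ℝ}
    (small : ∀ t i, 0 < α t i - s t * (u t i - average (u t)))
    (init : α 0 ∈ stdSimplex ℝ (Fin m))
    (update : ∀ t i, α (t + 1) i = α t i - s t * (u t i - average (u t))) (t : ℕ) :
    α t ∈ stdSimplex ℝ (Fin m) := by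
  induction t with
  | zero => exact init
  | succ t ih =>
    refine ⟨fun i => by rw [update]; exact (small t i).le, ?_⟩
    simp only [update, Finset.sum_sub_distrib, ← Finset.mul_sum]
    rw [← Finset.sum_sub_distrib, sum_sub_average, ih.2]
    ring

theorem sq_sum_abs_le (x : Fin m → ℝ) : (∑ j, |x j|) ^ 2 ≤ (∑ j, x j * x j) * m := by
  have h := sq_sum_le_card_mul_sum_sq (s := Finset.univ) (f := fun j => |x j|)
  simp only [sq_abs, Finset.card_univ, Fintype.card_fin] at h
  simpa only [mul_comm (m : ℝ), sq] using h

theorem abs_average_le {u : Fin m → ℝ} {K : ℝ} (hK : 0 ≤ K) (hu : ∀ i, |u i| ≤ K) :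
    |average u| ≤ K := by
  rw [average, abs_div, Nat.abs_cast]
  refine div_le_of_le_mul₀ (Nat.cast_nonneg m) hK ?_
  refine (Finset.abs_sum_le_sum_abs _ _).trans ((Finset.sum_le_sum fun i _ => hu i).trans ?_)
  simp [mul_comm]

theorem IsSupportMap.exists_bound (hU : IsSupportMap U) :
    ∃ K, 0 ≤ K ∧ ∀ β ∈ stdSimplex ℝ (Fin m), ∀ i, |U β i| ≤ K := by
  obtain ⟨K, hK⟩ := (isCompact_stdSimplex ℝ (Fin m)).exists_bound_of_continuousOn
    hU.continuousOn
  exact ⟨max K 0, le_max_right _ _, fun β hβ i =>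
    ((norm_le_pi_norm (U β) i).trans (hK β hβ)).trans (le_max_left _ _)⟩

/-- The excess of the value over its minimum is controlled by the deviation from the average. -/
theorem IsSupportMap.sub_le_sum_abs (hU : IsSupportMap U) {αs α : Fin m → ℝ}
    (hαs : αs ∈ stdSimplex ℝ (Fin m)) {v : ℝ} (hv : ∀ i, U αs i = v)
    (hα : α ∈ stdSimplex ℝ (Fin m)) :
    ∑ j, α j * U α j - v ≤ ∑ j, |U α j - average (U α)| := by
  have h1 := hU.sum_le α hα αs hαs
  simp only [hv, ← Finset.sum_mul, hαs.2, one_mul] at h1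
  have h2 := sum_mul_sub_average 0 (fun i => α i - αs i) (U α)
    (by rw [Finset.sum_sub_distrib, hα.2, hαs.2, sub_self])
  -- Subtracting the average is free since `α - αs` sums to zero; its coordinates lie in `[-1, 1]`.
  have h3 : ∑ i, (α i - αs i) * (U α i - average (U α)) ≤ ∑ j, |U α j - average (U α)| := by
    refine Finset.sum_le_sum fun i _ => (le_abs_self _).trans ?_
    rw [abs_mul]
    refine mul_le_of_le_one_left (abs_nonneg _) (abs_le.2 ⟨?_, ?_⟩)
    · linarith [hα.1 i, (mem_Icc_of_mem_stdSimplex hαs i).2]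
    · linarith [hαs.1 i, (mem_Icc_of_mem_stdSimplex hα i).2]
  have h4 : ∑ i, (α i - αs i) * U α i = ∑ i, α i * U α i - ∑ i, αs i * U α i := by
    simp only [sub_mul, Finset.sum_sub_distrib]
  linarith

/-- Convergence of the subgradient iteration for a support map. -/
theorem IsSupportMap.tendsto_iteration (hU : IsSupportMap U) {s : ℕ → ℝ} {α : ℕ → Fin m → ℝ}
    (hs : IsDiminishingStepRule s) (hα : ∀ t, α t ∈ stdSimplex ℝ (Fin m))
    (update : ∀ t i, α (t + 1) i = α t i - s t * (U (α t) i - average (U (α t))))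
    {αs : Fin m → ℝ} (hαs : αs ∈ stdSimplex ℝ (Fin m)) {v : ℝ} (hv : ∀ i, U αs i = v)
    (hmin : ∀ β ∈ stdSimplex ℝ (Fin m), v ≤ ∑ j, β j * U β j)
    (heq : ∀ β ∈ stdSimplex ℝ (Fin m), ∑ j, β j * U β j = v → ∀ i, U β i = v) :
    Tendsto (fun t => U (α t)) atTop (𝓝 fun _ => v) := by
  obtain ⟨K, hK0, hK⟩ := hU.exists_bound
  have hd : ∀ t i, |U (α t) i - average (U (α t))| ≤ 2 * K := fun t i => by
    have h1 := abs_le.1 (hK _ (hα t) i)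
    have h2 := abs_le.1 (abs_average_le hK0 (hK _ (hα t)))
    exact abs_le.2 ⟨by linarith, by linarith⟩
  -- The support inequality used here has its subgradient at the new point; `hclose` later allows
  -- exchanging it for the one at the old point.
  have hstep : ∀ t, ∑ j, α (t + 1) j * U (α (t + 1)) j ≤ ∑ j, α t j * U (α t) j -
      s t * ∑ j, U (α (t + 1)) j * (U (α t) j - average (U (α t))) := fun t => by
    have h1 := hU.sum_le _ (hα (t + 1)) _ (hα t)
    have h2 : ∑ j, α (t + 1) j * U (α (t + 1)) j = ∑ j, α t j * U (α (t + 1)) j -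
        s t * ∑ j, U (α (t + 1)) j * (U (α t) j - average (U (α t))) := by
      rw [Finset.mul_sum, ← Finset.sum_sub_distrib]
      refine Finset.sum_congr rfl fun j _ => ?_
      rw [update]
      ring
    linarith
  have hclose : Tendsto (fun t => dist (U (α (t + 1))) (U (α t))) atTop (𝓝 0) := by
    have huc := (isCompact_stdSimplex ℝ (Fin m)).uniformContinuousOn_of_continuous
      hU.continuousOn
    rw [Metric.uniformContinuousOn_iff] at huc
    rw [Metric.tendsto_atTop]
    intro ε hε
    obtain ⟨δ, hδ, h⟩ := huc ε hε
    have hlim := hs.2.1.mul_const (2 * K)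
    rw [zero_mul] at hlim
    obtain ⟨T, hT⟩ := eventually_atTop.1 (hlim.eventually (gt_mem_nhds hδ))
    refine ⟨T, fun t ht => ?_⟩
    rw [dist_zero_right, Real.norm_of_nonneg dist_nonneg]
    refine h _ (hα _) _ (hα _) (lt_of_le_of_lt ?_ (hT t ht))
    refine (dist_pi_le_iff (mul_nonneg (hs.1 t).le (by positivity))).2 fun i => ?_
    rw [update, Real.dist_eq, show ∀ x y : ℝ, x - y - x = -y by intros; ring, abs_neg, abs_mul,
      abs_of_pos (hs.1 t)]
    exact mul_le_mul_of_nonneg_left (hd t i) (hs.1 t).le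
  have hvalue : Tendsto (fun t => ∑ j, α t j * U (α t) j - v) atTop (𝓝 0) := by
    refine tendsto_zero_of_descent (fun t => sub_nonneg.2 (hmin _ (hα t))) hs
      (M := ∑ _j : Fin m, K * (2 * K)) (fun t => ?_) fun ε hε => ?_
    · have h1 : -∑ j, U (α (t + 1)) j * (U (α t) j - average (U (α t))) ≤
          ∑ _j : Fin m, K * (2 * K) := by
        rw [← Finset.sum_neg_distrib]
        refine Finset.sum_le_sum fun j _ => (neg_le_abs _).trans ?_
        rw [abs_mul]
        exact mul_le_mul (hK _ (hα _) j) (hd t j) (abs_nonneg _) hK0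
      have := mul_le_mul_of_nonneg_left h1 (hs.1 t).le
      linarith [hstep t]
    · have hm : 0 < (m : ℝ) := by
        obtain ⟨k, -⟩ := exists_pos_of_mem_stdSimplex hαs
        exact_mod_cast k.pos
      -- An excess of at least `ε` forces the squared deviation to be at least `ε ^ 2 / m` by
      -- Cauchy–Schwarz; half of it absorbs the error of replacing the new subgradient by the old.
      refine ⟨ε ^ 2 / m / 2, by positivity, ?_⟩
      have herr := hclose.mul_const (∑ _j : Fin m, 2 * K)
      rw [zero_mul] at herr
      filter_upwards [herr.eventually (gt_mem_nhds (show 0 < ε ^ 2 / m / 2 by positivity))]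
        with t ht hεt
      have h1 : ∑ j, (U (α t) j - average (U (α t))) * (U (α t) j - average (U (α t))) -
          ∑ j, U (α (t + 1)) j * (U (α t) j - average (U (α t))) ≤
          dist (U (α (t + 1))) (U (α t)) * ∑ _j : Fin m, 2 * K := by
        rw [sum_mul_sub_average 0 _ _ (sum_sub_average _), zero_mul, sub_zero,
          ← Finset.sum_sub_distrib, Finset.mul_sum]
        refine Finset.sum_le_sum fun j _ => ?_
        rw [mul_comm, ← sub_mul]
        refine (le_abs_self _).trans ?_
        rw [abs_mul, ← Real.dist_eq, dist_comm]
        exact mul_le_mul (dist_le_pi_dist _ _ j) (hd t j) (abs_nonneg _) dist_nonneg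
      have h2 := hU.sub_le_sum_abs hαs hv (hα t)
      have h3 := sq_sum_abs_le fun j => U (α t) j - average (U (α t))
      have h4 : ε ^ 2 / m ≤
          ∑ j, (U (α t) j - average (U (α t))) * (U (α t) j - average (U (α t))) := by
        rw [div_le_iff₀ hm]
        have h5 : ε ^ 2 ≤ (∑ j, |U (α t) j - average (U (α t))|) ^ 2 :=
          pow_le_pow_left₀ hε.le (hεt.trans h2) 2
        linarith
      have h6 := mul_le_mul_of_nonneg_left (show ε ^ 2 / m / 2 ≤
        ∑ j, U (α (t + 1)) j * (U (α t) j - average (U (α t))) by linarith) (hs.1 t).le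
      linarith [hstep t]
  rw [Metric.tendsto_nhds]
  intro ε hε
  -- Where `U` stays `ε`-far from the constant vector, the excess of `G` has a positive minimum by
  -- compactness, so small excess forces `U` close.
  have hcpt : IsCompact (stdSimplex ℝ (Fin m) ∩ {β | ε ≤ dist (U β) fun _ => v}) := by
    refine (isCompact_stdSimplex ℝ (Fin m)).of_isClosed_subset ?_ inter_subset_left
    exact ((continuous_id.dist continuous_const).comp_continuousOn hU.continuousOn).preimage_isClosed_of_isClosed
      (isCompact_stdSimplex ℝ (Fin m)).isClosed (isClosed_Ici (a := ε))
  rcases (stdSimplex ℝ (Fin m) ∩ {β | ε ≤ dist (U β) fun _ => v}).eq_empty_or_nonempty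
    with hemp | hne
  · refine Eventually.of_forall fun t => ?_
    by_contra hcon
    exact notMem_empty (α t) (hemp ▸ ⟨hα t, not_lt.1 hcon⟩)
  · obtain ⟨β, ⟨hβ, hβε⟩, hβmin⟩ := hcpt.exists_isMinOn hne
      (hU.continuousOn_sum.mono inter_subset_left)
    rw [isMinOn_iff] at hβmin
    have hβv : 0 < ∑ j, β j * U β j - v := by
      refine lt_of_le_of_ne (sub_nonneg.2 (hmin β hβ)) fun h => ?_
      have h0 : U β = fun _ => v := funext (heq β hβ (by linarith))
      rw [mem_ofPred_eq, h0, dist_self] at hβε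
      linarith
    filter_upwards [hvalue.eventually (gt_mem_nhds hβv)] with t ht
    by_contra hcon
    linarith [hβmin (α t) ⟨hα t, not_lt.1 hcon⟩]

end

/-! ### From measures to densities, and from payoffs to the maxmin value. -/

section

variable {Ω : Type*} [MeasurableSpace Ω] {n m : ℕ}

/-- The density of a player's measure with respect to a reference measure. -/
def density (μ : Fin n → Measure Ω) (ν : Measure Ω) (i : Fin n) (x : Ω) : ℝ :=
  ((μ i).rnDeriv ν x).toReal

/-- The largest density in a coalition. -/
def coalitionDensity (μ : Fin n → Measure Ω) (ν : Measure Ω) {S : Finset (Fin n)}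
    (hS : S.Nonempty) (x : Ω) : ℝ :=
  S.sup' hS fun i => density μ ν i x

theorem measurable_density (μ : Fin n → Measure Ω) (ν : Measure Ω) (i : Fin n) :
    Measurable (density μ ν i) :=
  (Measure.measurable_rnDeriv _ _).ennreal_toReal

theorem measurable_coalitionDensity (μ : Fin n → Measure Ω) (ν : Measure Ω) {S : Finset (Fin n)}
    (hS : S.Nonempty) : Measurable (coalitionDensity μ ν hS) := by
  have h := Finset.measurable_sup' hS fun i (_ : i ∈ S) => measurable_density μ ν i
  convert h using 1
  ext x
  simp [coalitionDensity]

theorem exists_coalitionDensity_eq (μ : Fin n → Measure Ω) (ν : Measure Ω) {S : Finset (Fin n)}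
    (hS : S.Nonempty) (x : Ω) : ∃ i ∈ S, coalitionDensity μ ν hS x = density μ ν i x :=
  S.exists_mem_eq_sup' hS _

theorem density_le_coalitionDensity (μ : Fin n → Measure Ω) (ν : Measure Ω) {S : Finset (Fin n)}
    (hS : S.Nonempty) {i : Fin n} (hi : i ∈ S) (x : Ω) :
    density μ ν i x ≤ coalitionDensity μ ν hS x :=
  S.le_sup' (fun i => density μ ν i x) hi

theorem integrable_density (μ : Fin n → Measure Ω) [∀ i, IsFiniteMeasure (μ i)] (ν : Measure Ω)
    (i : Fin n) : Integrable (density μ ν i) ν :=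
  Measure.integrable_toReal_rnDeriv

theorem integrable_coalitionDensity (μ : Fin n → Measure Ω) [∀ i, IsFiniteMeasure (μ i)]
    (ν : Measure Ω) {S : Finset (Fin n)} (hS : S.Nonempty) :
    Integrable (coalitionDensity μ ν hS) ν := by
  refine Integrable.mono' (integrable_finsetSum S fun i _ => integrable_density μ ν i)
    (measurable_coalitionDensity μ ν hS).aestronglyMeasurable (ae_of_all _ fun x => ?_)
  obtain ⟨i, hi, h⟩ := exists_coalitionDensity_eq μ ν hS x
  rw [h, Real.norm_of_nonneg (show 0 ≤ density μ ν i x from ENNReal.toReal_nonneg)]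
  exact Finset.single_le_sum (f := fun i => density μ ν i x)
    (fun k _ => ENNReal.toReal_nonneg) hi

/-- The joint utility of a coalition is the integral of the largest density. -/
theorem coalitionValue_eq (μ : Fin n → Measure Ω) [∀ i, IsFiniteMeasure (μ i)] (ν : Measure Ω)
    [SigmaFinite ν] (hμν : ∀ i, μ i ≪ ν) {S : Finset (Fin n)} (hS : S.Nonempty) {B : Set Ω}
    (hB : MeasurableSet B) :
    coalitionValue μ S B = ∫ x in B, coalitionDensity μ ν hS x ∂ν := by
  have hreal (i : Fin n) (D : Set Ω) : (μ i).real D = ∫ x in D, density μ ν i x ∂ν :=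
    (Measure.setIntegral_toReal_rnDeriv (hμν i) D).symm
  have hint := integrable_coalitionDensity μ ν hS
  refine IsGreatest.csSup_eq ⟨?_, ?_⟩
  · have : Nonempty S := hS.to_subtype
    obtain ⟨D, hD, hmax⟩ := exists_isMeasPartition_argmax
      (fun i : S => measurable_density μ ν i) hB
    refine ⟨D, hD, ?_⟩
    rw [← hD.sum_setIntegral hint]
    refine Finset.sum_congr rfl fun i _ => ?_
    rw [hreal]
    refine setIntegral_congr_fun (hD.1 i) fun x hx => ?_
    refine le_antisymm ?_ (density_le_coalitionDensity μ ν hS i.2 x)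
    exact Finset.sup'_le hS _ fun k hk => hmax i x hx ⟨k, hk⟩
  · rintro _ ⟨D, hD, rfl⟩
    rw [← hD.sum_setIntegral hint]
    refine Finset.sum_le_sum fun i _ => ?_
    rw [hreal]
    exact setIntegral_mono (integrable_density μ ν i).integrableOn hint.integrableOn
      (density_le_coalitionDensity μ ν hS i.2)

/-- The densities of distinct players are nowhere proportional under relative disagreement. -/
theorem ae_density_ne_mul (μ : Fin n → Measure Ω) [∀ i, IsFiniteMeasure (μ i)] (ν : Measure Ω)
    [SigmaFinite ν] (hμν : ∀ i, μ i ≪ ν) (hνμ : ∀ i, ν ≪ μ i) (hRD : RelativeDisagreement μ)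
    {i j : Fin n} (hij : i ≠ j) (c : ℝ) : ∀ᵐ x ∂ν, density μ ν i x ≠ c * density μ ν j x := by
  have hA : MeasurableSet {x | density μ ν i x = c * density μ ν j x} :=
    measurableSet_eq_fun (measurable_density μ ν i) ((measurable_density μ ν j).const_mul c)
  set A := {x | density μ ν i x = c * density μ ν j x}
  have hreal (i : Fin n) (D : Set Ω) : (μ i).real D = ∫ x in D, density μ ν i x ∂ν :=
    (Measure.setIntegral_toReal_rnDeriv (hμν i) D).symm
  have hprop : ∀ B ⊆ A, MeasurableSet B → (μ i).real B = c * (μ j).real B := by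
    intro B hBA hB
    rw [hreal, hreal, ← integral_const_mul]
    exact setIntegral_congr_fun hB fun x hx => hBA hx
  suffices hA0 : ν A = 0 from measure_eq_zero_iff_ae_notMem.1 hA0
  by_contra hne
  have hpos (k : Fin n) : 0 < μ k A := pos_iff_ne_zero.2 fun h => hne (hνμ k h)
  obtain ⟨B, hBA, hB, hBne⟩ := hRD i j hij A hA (hpos i) (hpos j)
  refine hBne ?_
  have hi : (μ i).real A ≠ 0 := (ENNReal.toReal_pos (hpos i).ne' (measure_ne_top _ _)).ne'
  have hj : (μ j).real A ≠ 0 := (ENNReal.toReal_pos (hpos j).ne' (measure_ne_top _ _)).ne'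
  rw [hprop A subset_rfl hA] at hi
  rw [hprop B hBA hB, hprop A subset_rfl hA]
  -- A zero ratio would make player `i`'s measure of `A` vanish; otherwise `c` cancels,
  -- contradicting RD on `A`.
  have hc : c ≠ 0 := left_ne_zero_of_mul hi
  exact mul_div_mul_left _ _ hc

/-- The density of the weighted preference of a coalition. -/
def weightedDensity (μ : Fin n → Measure Ω) (ν : Measure Ω) {S : Fin m → Finset (Fin n)}
    (hS : IsCoalitionStructure S) (w : Finset (Fin n) → ℝ) (j : Fin m) (x : Ω) : ℝ :=
  coalitionDensity μ ν (hS.1 j) x / w (S j)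

theorem weightedValue_eq (μ : Fin n → Measure Ω) [∀ i, IsFiniteMeasure (μ i)] (ν : Measure Ω)
    [SigmaFinite ν] (hμν : ∀ i, μ i ≪ ν) {S : Fin m → Finset (Fin n)}
    (hS : IsCoalitionStructure S) (w : Finset (Fin n) → ℝ) (j : Fin m) {B : Set Ω}
    (hB : MeasurableSet B) :
    weightedValue μ S w j B = ∫ x in B, weightedDensity μ ν hS w j x ∂ν := by
  simp only [weightedDensity, weightedValue]
  rw [integral_div, coalitionValue_eq μ ν hμν (hS.1 j) hB]

/-- At each point the two coalition maxima are attained by players of disjoint coalitions, so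
proportionality reduces to finitely many pairs of distinct players, with the weights absorbed in the
ratio. -/
theorem isDisagreeing_weightedDensity (μ : Fin n → Measure Ω) [∀ i, IsFiniteMeasure (μ i)]
    (ν : Measure Ω) [SigmaFinite ν] (hμν : ∀ i, μ i ≪ ν) (hνμ : ∀ i, ν ≪ μ i)
    (hRD : RelativeDisagreement μ) {S : Fin m → Finset (Fin n)} (hS : IsCoalitionStructure S)
    {w : Finset (Fin n) → ℝ} (hw : ∀ j, 0 < w (S j)) :
    IsDisagreeing ν (weightedDensity μ ν hS w) where
  measurable j := (measurable_coalitionDensity μ ν (hS.1 j)).div_const _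
  integrable j := (integrable_coalitionDensity μ ν (hS.1 j)).div_const _
  pos j := by
    have hpos : ∀ᵐ x ∂ν, ∀ i, 0 < density μ ν i x := ae_all_iff.2 fun i => by
      filter_upwards [Measure.rnDeriv_pos' (hνμ i), Measure.rnDeriv_lt_top (μ i) ν] with x h1 h2
      exact ENNReal.toReal_pos h1.ne' h2.ne
    filter_upwards [hpos] with x hx
    obtain ⟨i, -, h⟩ := exists_coalitionDensity_eq μ ν (hS.1 j) x
    exact div_pos (h ▸ hx i) (hw j)
  ne_mul j k hjk c := by
    have hne : ∀ᵐ x ∂ν, ∀ a b, a ≠ b →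
        density μ ν a x ≠ c * w (S j) / w (S k) * density μ ν b x := by
      simp only [ae_all_iff]
      exact fun a b hab => ae_density_ne_mul μ ν hμν hνμ hRD hab _
    filter_upwards [hne] with x hx
    obtain ⟨a, ha, hja⟩ := exists_coalitionDensity_eq μ ν (hS.1 j) x
    obtain ⟨b, hb, hkb⟩ := exists_coalitionDensity_eq μ ν (hS.1 k) x
    have hab : a ≠ b := fun h => Finset.disjoint_left.1 (hS.2.1 j k hjk) ha (h ▸ hb)
    simp only [weightedDensity, hja, hkb]
    refine fun heq => hx a b hab ?_
    rw [div_eq_iff (hw j).ne'] at heq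
    rw [heq]
    ring

theorem IsDisagreeing.isSupportMap {ν : Measure Ω} [NeZero ν] {g : Fin m → Ω → ℝ}
    (hg : IsDisagreeing ν g) (hm : 0 < m) : IsSupportMap (payoff ν g) := by
  have : Nonempty (Fin m) := ⟨⟨0, hm⟩⟩
  exact ⟨hg.continuousOn_payoff, fun _ hα _ hβ => hg.sum_payoff_le hα hβ,
    fun _ hα _ hi => hg.payoff_eq_zero hα hi, fun _ hα => hg.sum_payoff_pos hα⟩

theorem lowerBound_const (μ : Fin n → Measure Ω) (S : Fin m → Finset (Fin n))
    (w : Finset (Fin n) → ℝ) (v : ℝ) (h : Fin m) :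
    lowerBound μ S w (fun _ => v) h = v := by
  simp [lowerBound]

theorem tendsto_lowerBound (μ : Fin n → Measure Ω) (S : Fin m → Finset (Fin n))
    (w : Finset (Fin n) → ℝ) {v : ℝ} {u : ℕ → Fin m → ℝ} (hu : Tendsto u atTop (𝓝 fun _ => v))
    (h : ℕ → Fin m) : Tendsto (fun t => lowerBound μ S w (u t) (h t)) atTop (𝓝 v) := by
  -- The index `h t` may vary with `t`; convergence for each of the finitely many fixed indices
  -- suffices.
  have hk (k : Fin m) : Tendsto (fun t => lowerBound μ S w (u t) k) atTop (𝓝 v) := by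
    have hcont : ContinuousAt (fun u => lowerBound μ S w u k) fun _ => v := by
      unfold lowerBound
      refine ContinuousAt.div (continuous_apply k).continuousAt ?_ (by simp)
      exact continuousAt_const.add (tendsto_finsetSum _ fun j _ =>
        ((continuous_apply k).sub (continuous_apply j)).continuousAt.div_const _)
    have := hcont.tendsto.comp hu
    rwa [lowerBound_const] at this
  rw [Metric.tendsto_nhds]
  intro ε hε
  filter_upwards [eventually_all.2 fun k => Metric.tendsto_nhds.1 (hk k) ε hε] with t ht
  exact ht (h t)

/-- A partition whose weighted values form a constant vector, and whose common value bounds a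
weighted average of the values of every partition, attains the maxmin value. -/
theorem isGreatest_minValues (hm : 0 < m) {μ : Fin n → Measure Ω} {S : Fin m → Finset (Fin n)}
    {w : Finset (Fin n) → ℝ} {α : Fin m → ℝ} (hα : α ∈ stdSimplex ℝ (Fin m)) {v : ℝ}
    (hv : IsPVV μ S w α fun _ => v) : IsGreatest (minValues μ S w) v := by
  have : Nonempty (Fin m) := ⟨⟨0, hm⟩⟩
  obtain ⟨B, hB, hBv⟩ := hv
  refine ⟨⟨B, hB.1, by simp [← hBv]⟩, ?_⟩
  rintro _ ⟨B', hB', rfl⟩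
  have h1 := hB.2 B' hB'
  simp only [← hBv, ← Finset.sum_mul, hα.2, one_mul] at h1
  refine le_trans ?_ h1
  calc ⨅ j, weightedValue μ S w j (B' j)
      = ∑ k, α k * ⨅ j, weightedValue μ S w j (B' j) := by rw [← Finset.sum_mul, hα.2, one_mul]
    _ ≤ _ := Finset.sum_le_sum fun k _ =>
      mul_le_mul_of_nonneg_left (ciInf_le (Finite.bddBelow_range _) k) (hα.1 k)

section PVV

variable {μ : Fin n → Measure Ω} {S : Fin m → Finset (Fin n)} {w : Finset (Fin n) → ℝ}
  {ν : Measure Ω} {g : Fin m → Ω → ℝ} {α : Fin m → ℝ}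

/-- The partition value vector is unique. -/
theorem isPVV_iff (hm : 0 < m) (hg : IsDisagreeing ν g)
    (hwg : ∀ j B, MeasurableSet B → weightedValue μ S w j B = ∫ x in B, g j x ∂ν)
    (hα : α ∈ stdSimplex ℝ (Fin m)) {u : Fin m → ℝ} :
    IsPVV μ S w α u ↔ u = payoff ν g α := by
  have : Nonempty (Fin m) := ⟨⟨0, hm⟩⟩
  obtain ⟨D, hD, hDv⟩ := hg.exists_partition hα
  have hval {B : Fin m → Set Ω} (hB : IsMeasPartition univ B) (j : Fin m) :
      weightedValue μ S w j (B j) = ∫ x in B j, g j x ∂ν := hwg j _ (hB.1 j)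
  constructor
  · rintro ⟨B, hB, hBu⟩
    ext j
    rw [hBu, hval hB.1]
    refine hg.setIntegral_eq_payoff hα hB.1 ?_ j
    simpa only [hval hD, hval hB.1, hDv] using hB.2 D hD
  · rintro rfl
    refine ⟨D, ⟨hD, fun B' hB' => ?_⟩, fun j => by rw [hval hD, hDv]⟩
    simp only [hval hD, hval hB', hDv]
    exact hg.sum_le_sum_payoff hα hB'

end PVV

end

end FairDivision

end

/-! ### Assembly of the theorem. -/

theorem mainTheorem4 {d n m : ℕ} (C : Set (EuclideanSpace ℝ (Fin d))) (hC : MeasurableSet C)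
    (μ : Fin n → Measure C) [hμ : ∀ i, IsProbabilityMeasure (μ i)]
    (S : Fin m → Finset (Fin n)) (hS : FairDivision.IsCoalitionStructure S)
    (w : Finset (Fin n) → ℝ) (hw : ∀ j, 0 < w (S j))
    (hCD : FairDivision.CompleteDivisibility μ)
    (hMAC : FairDivision.MutualAbsContinuity μ)
    (hRD : FairDivision.RelativeDisagreement μ)
    (s : ℕ → ℝ) (α u : ℕ → Fin m → ℝ)
    (hiter : FairDivision.IsSubgradientIteration μ S w s α u)
    (h : ℕ → Fin m) (hmax : ∀ t j, u t j ≤ u t (h t)) :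
    IsGreatest (FairDivision.minValues μ S w) (FairDivision.maxminValue μ S w) ∧
    ((∃ t, (u t = fun _ => FairDivision.maxminValue μ S w) ∧
        FairDivision.lowerBound μ S w (u t) (h t) = FairDivision.maxminValue μ S w) ∨
      (Tendsto u atTop (𝓝 fun _ => FairDivision.maxminValue μ S w) ∧
        Tendsto (fun t => FairDivision.lowerBound μ S w (u t) (h t)) atTop
          (𝓝 (FairDivision.maxminValue μ S w)))) := by
  have hm : 0 < m := (h 0).pos
  obtain ⟨i₀, -⟩ := hS.1 (h 0)
  have hac : ∀ i j, μ i ≪ μ j := fun i j => by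
    rcases eq_or_ne i j with rfl | hij
    · exact Measure.AbsolutelyContinuous.rfl
    · refine Measure.AbsolutelyContinuous.mk fun A hA hA0 => ?_
      by_contra hne
      exact (hMAC i A hA (pos_iff_ne_zero.2 hne) j hij.symm).ne' hA0
  -- Any single player's measure serves as reference, all of them being equivalent.
  have hg := FairDivision.isDisagreeing_weightedDensity μ (μ i₀) (fun i => hac i i₀)
    (fun i => hac i₀ i) hRD hS hw
  have hpvv := fun (β : Fin m → ℝ) (hβ : β ∈ stdSimplex ℝ (Fin m)) (x : Fin m → ℝ) =>
    FairDivision.isPVV_iff hm hg (fun j B hB => FairDivision.weightedValue_eq μ (μ i₀)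
      (fun i => hac i i₀) hS w j hB) hβ (u := x)
  have hU := hg.isSupportMap hm
  obtain ⟨αs, hαs, v, hv, hmin, heq⟩ := hU.exists_min hm
  have hgreat := FairDivision.isGreatest_minValues hm hαs ((hpvv αs hαs _).2 (funext hv).symm)
  have hvv : FairDivision.maxminValue μ S w = v := hgreat.csSup_eq
  have hα := FairDivision.mem_stdSimplex_of_iteration hiter.small hiter.init hiter.update
  have hu : ∀ t, u t = _ := fun t => (hpvv _ (hα t) _).1 (hiter.pvv t)
  have htend : Tendsto u atTop (𝓝 fun _ => v) := by
    have := hU.tendsto_iteration hiter.step hα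
      (fun t i => by rw [hiter.update, hu]) hαs hv hmin heq
    rwa [← funext hu] at this
  rw [hvv]
  -- The limit alternative always holds, even if some `u t` is already constant.
  exact ⟨hgreat, Or.inr ⟨htend, FairDivision.tendsto_lowerBound μ S w htend h⟩⟩
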